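/- All vector spaces are real. A Banach sequence lattice is a linear space $Y\subset\mathbb R^{\mathbb N}$ with a complete norm $\|\cdot\|_Y$ such that every canonical sequence $e_n$ lies in $Y$ and such that $g\in Y$, $f\in\mathbb R^{\mathbb N}$, $|f|\le|g|$ imply $f\in Y$ and $\|f\|_Y\le\|g\|_Y$. Write $\|(t_1,\dots,t_n)\|_{\mathbb R^n,Y}=\|(t_1,\dots,t_n,0,0,\dots)\|_Y$. Let $Y$ be a Banach sequence lattice, $E$ a Banach space and $X$ a Banach lattice. For $w\in E^n$ let $\|w\|_{E^n,Y}=\|(\|w_1\|_E,\dots,\|w_n\|_E)\|_{\mathbb R^n,Y}$. For $x\in X^n$ let $\|x\|_{X^n,Y,\tau}=\|\tau_{n,x}(\|\cdot\|_{\mathbb R^n,Y})\|_X$, where $\tau_{n,x}$ is Krivine's functional calculus: the unique linear map, from the space of continuous functions $\mathbb R^n\to\mathbb R$ that are homogeneous of degree $1$ (for scalars $\lambda\ge 0$) to $X$, that sends the $j$-th coordinate projection to $x_j$ for each $j$ and preserves finite suprema. A linear map $T:E\to X$ is $Y$-convex if there is a constant $C>0$ with $\|(Tw_1,\dots,Tw_n)\|_{X^n,Y,\tau}\le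 C\|(w_1,\dots,w_n)\|_{E^n,Y}$ for all $n\in\mathbb N$ and $w_1,\dots,w_n\in E$; the smallest constant $C\ge 0$ for which this holds is denoted by $\|T\|_{\mathcal K^Y}$. A linear map $S:X\to E$ is $Y$-concave if there is a constant $K>0$ with $\|(Sx_1,\dots,Sx_n)\|_{E^n,Y}\le K\|(x_1,\dots,x_n)\|_{X^n,Y,\tau}$ for all $n\in\mathbb N$ and $x_1,\dots,x_n\in X$; the smallest constant $K\ge 0$ for which this holds is denoted by $\|S\|_{\mathcal K_Y}$. Let $\ell^Y(E)=\{w\in E^{\mathbb N}:(\|w_j\|_E)_j\in Y\}$ with the norm $\|w\|_{\ell^Y(E)}=\|(\|w_j\|_E)_j\|_Y$, and let $\ell^{\tau,Y}(X)=\{x\in X^{\mathbb N}:\sup_n\|(x_1,\dots,x_n)\|_{X^n,Y,\tau}<\infty\}$ with that supremum as the norm. Let $\ell_0^Y(E)$ and $\ell_0^{\tau,Y}(X)$ be the closures in these spaces of their subspaces of eventually zero sequences. For a linear map $T$ write $\widetilde T(\{v_j\}_j)=\{Tv_j\}_j$. **Theorem.** (i) A linear operator $T:E\to X$ is $Y$-convex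 if and only if $\widetilde T$ maps $\ell_0^Y(E)$ into $\ell_0^{\tau,Y}(X)$ and is bounded as an operator $\ell_0^Y(E)\to\ell_0^{\tau,Y}(X)$, in which case its operator norm is $\|\widetilde T\|=\|T\|_{\mathcal K^Y}$. (ii) A linear operator $S:X\to E$ is $Y$-concave if and only if $\widetilde S$ maps $\ell_0^{\tau,Y}(X)$ into $\ell_0^Y(E)$ and is bounded as an operator $\ell_0^{\tau,Y}(X)\to\ell_0^Y(E)$, in which case its operator norm is $\|\widetilde S\|=\|S\|_{\mathcal K_Y}$. -/

import Mathlib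

noncomputable section

/-- A Banach sequence lattice: an ideal `Y` of the space of all real sequences that contains every
canonical sequence `e_n` and is a Banach space for an order-preserving norm.
The function `nrm` is only meaningful on `carrier`, and all its laws are only required there. -/
structure BanachSeqLattice where
  /-- the underlying linear space of sequences -/
  carrier : Submodule ℝ (ℕ → ℝ)
  /-- the norm of the elements of `carrier` -/
  nrm : (ℕ → ℝ) → ℝ
  nrm_add_le : ∀ f ∈ carrier, ∀ g ∈ carrier, nrm (f + g) ≤ nrm f + nrm g
  nrm_smul : ∀ (c : ℝ), ∀ f ∈ carrier, nrm (c • f) = |c| * nrm f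
  eq_zero_of_nrm : ∀ f ∈ carrier, nrm f = 0 → f = 0
  /-- the ideal property -/
  solid_mem : ∀ f g : ℕ → ℝ, g ∈ carrier → (∀ j, |f j| ≤ |g j|) → f ∈ carrier
  /-- the norm is order-preserving -/
  solid_nrm : ∀ f g : ℕ → ℝ, g ∈ carrier → (∀ j, |f j| ≤ |g j|) → nrm f ≤ nrm g
  /-- every Cauchy sequence converges -/
  complete : ∀ u : ℕ → ℕ → ℝ, (∀ m, u m ∈ carrier) →
    (∀ ε > 0, ∃ N, ∀ m ≥ N, ∀ k ≥ N, nrm (u m - u k) < ε) →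
    ∃ f ∈ carrier, ∀ ε > 0, ∃ N, ∀ m ≥ N, nrm (u m - f) < ε
  single_mem : ∀ n : ℕ, (Pi.single n 1 : ℕ → ℝ) ∈ carrier

/-- The finite sequence `(t_1, …, t_n)` seen as the sequence `(t_1, …, t_n, 0, 0, …)`. -/
def padZero (n : ℕ) : (Fin n → ℝ) →ₗ[ℝ] (ℕ → ℝ) where
  toFun t j := if h : j < n then t ⟨j, h⟩ else 0
  map_add' s t := by
    ext j
    by_cases h : j < n <;> simp [h]
  map_smul' c t := by
    ext j
    by_cases h : j < n <;> simp [h]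

theorem padZero_single (n : ℕ) (i : Fin n) :
    padZero n (Pi.single i 1) = Pi.single (i : ℕ) 1 := by
  ext j
  by_cases h : j < n
  · simp [padZero, h, Pi.single_apply, Fin.ext_iff]
  · have : j ≠ i := fun e => h (e ▸ i.2)
    simp [padZero, h, this]

namespace BanachSeqLattice

variable (Y : BanachSeqLattice)

theorem padZero_mem (n : ℕ) (t : Fin n → ℝ) : padZero n t ∈ Y.carrier := by
  have h : t = ∑ i, t i • (Pi.single i 1 : Fin n → ℝ) := by
    ext j
    simp [Finset.sum_apply, Pi.single_apply]
  rw [h, map_sum]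
  refine Submodule.sum_mem _ fun i _ => ?_
  rw [map_smul, padZero_single]
  exact Y.carrier.smul_mem _ (Y.single_mem _)

/-- The norm of `Y` restricted to `ℝ^n`. -/
def finNorm (n : ℕ) (t : Fin n → ℝ) : ℝ := Y.nrm (padZero n t)

theorem finNorm_smul (n : ℕ) (c : ℝ) (t : Fin n → ℝ) :
    Y.finNorm n (c • t) = |c| * Y.finNorm n t := by
  unfold finNorm
  rw [map_smul, Y.nrm_smul c _ (Y.padZero_mem n t)]

theorem finNorm_add_le (n : ℕ) (s t : Fin n → ℝ) :
    Y.finNorm n (s + t) ≤ Y.finNorm n s + Y.finNorm n t := by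
  unfold finNorm
  rw [map_add]
  exact Y.nrm_add_le _ (Y.padZero_mem n s) _ (Y.padZero_mem n t)

theorem continuous_finNorm (n : ℕ) : Continuous (Y.finNorm n) := by
  have hconv : ConvexOn ℝ Set.univ (Y.finNorm n) := by
    refine ⟨convex_univ, fun s _ t _ a b ha hb _ => ?_⟩
    refine (Y.finNorm_add_le n _ _).trans ?_
    rw [finNorm_smul, finNorm_smul, abs_of_nonneg ha, abs_of_nonneg hb, smul_eq_mul, smul_eq_mul]
  exact continuousOn_univ.mp (hconv.continuousOn isOpen_univ)

end BanachSeqLattice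

/-- The space `H_n` of the continuous functions `h : ℝ^n → ℝ` that are (positively) homogeneous of
degree `1`. -/
def HomogFun (n : ℕ) : Submodule ℝ C(Fin n → ℝ, ℝ) where
  carrier := {h | ∀ c : ℝ, 0 ≤ c → ∀ t : Fin n → ℝ, h (c • t) = c * h t}
  add_mem' := by
    intro f g hf hg c hc t
    simp [hf c hc t, hg c hc t, mul_add]
  zero_mem' := by
    intro c _ t
    simp
  smul_mem' := by
    intro a f hf c hc t
    simp [hf c hc t, mul_left_comm]

namespace HomogFun

/-- The `j`-th coordinate projection, as an element of `H_n`. -/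
def proj {n : ℕ} (j : Fin n) : HomogFun n :=
  ⟨⟨fun t => t j, continuous_apply j⟩, fun c _ t => by simp⟩

/-- The pointwise maximum of two elements of `H_n`. -/
def sup {n : ℕ} (h₁ h₂ : HomogFun n) : HomogFun n :=
  ⟨h₁.1 ⊔ h₂.1, fun c hc t => by
    simp only [ContinuousMap.sup_apply]
    rw [h₁.2 c hc t, h₂.2 c hc t, mul_max_of_nonneg _ _ hc]⟩

/-- The norm of `Y` restricted to `ℝ^n`, as an element of `H_n`. -/
def ofNorm (Y : BanachSeqLattice) (n : ℕ) : HomogFun n :=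
  ⟨⟨Y.finNorm n, Y.continuous_finNorm n⟩, fun c hc t => by
    simpa [abs_of_nonneg hc] using Y.finNorm_smul n c t⟩

end HomogFun

section Krivine

variable {X : Type*} [NormedAddCommGroup X] [NormedSpace ℝ X] [Lattice X]

/-- `τ` is a Krivine functional calculus for `x = (x_1, …, x_n)`: a linear map `H_n → X` that sends
the `j`-th projection to `x_j` and preserves finite suprema. -/
structure IsKrivineCalculus {n : ℕ} (x : Fin n → X) (τ : HomogFun n →ₗ[ℝ] X) : Prop where
  map_proj : ∀ j, τ (HomogFun.proj j) = x j
  map_sup : ∀ h₁ h₂, τ (HomogFun.sup h₁ h₂) = τ h₁ ⊔ τ h₂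

open Classical in
/-- Krivine's functional calculus `τ_{n,x}`: the unique linear map `H_n → X` that sends the
projections to the `x_j` and preserves suprema. In a Banach lattice such a map exists for every `x`,
so the second branch is never taken there. -/
def krivine {n : ℕ} (x : Fin n → X) : HomogFun n →ₗ[ℝ] X :=
  if h : ∃ τ : HomogFun n →ₗ[ℝ] X, IsKrivineCalculus x τ then h.choose else 0

/-- `‖x‖_{X^n,Y,τ} = ‖τ_{n,x}(‖·‖_{ℝ^n,Y})‖_X`. -/
def tauNorm (Y : BanachSeqLattice) {n : ℕ} (x : Fin n → X) : ℝ :=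
  ‖krivine x (HomogFun.ofNorm Y n)‖

end Krivine

/-- `‖w‖_{E^n,Y} = ‖(‖w_1‖, …, ‖w_n‖)‖_{ℝ^n,Y}`. -/
def vecNorm {E : Type*} [NormedAddCommGroup E] (Y : BanachSeqLattice) {n : ℕ} (w : Fin n → E) : ℝ :=
  Y.finNorm n (fun i => ‖w i‖)

section ConvexConcave

variable {E X : Type*} [NormedAddCommGroup E] [NormedSpace ℝ E]
  [NormedAddCommGroup X] [NormedSpace ℝ X] [Lattice X]

/-- `C` is admissible in the inequality that defines `Y`-convexity of `T`. -/
def ConvexBound (Y : BanachSeqLattice) (T : E →ₗ[ℝ] X) (C : ℝ) : Prop :=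
  ∀ (n : ℕ) (w : Fin n → E), tauNorm Y (fun i => T (w i)) ≤ C * vecNorm Y w

/-- `T : E → X` is `Y`-convex. -/
def IsYConvex (Y : BanachSeqLattice) (T : E →ₗ[ℝ] X) : Prop :=
  ∃ C : ℝ, 0 < C ∧ ConvexBound Y T C

/-- The `Y`-convexity constant `‖T‖_{K^Y}` (for a `Y`-convex `T`): the smallest admissible
constant. -/
def convexConst (Y : BanachSeqLattice) (T : E →ₗ[ℝ] X) : ℝ :=
  sInf {C : ℝ | 0 ≤ C ∧ ConvexBound Y T C}

/-- `K` is admissible in the inequality that defines `Y`-concavity of `S`. -/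
def ConcaveBound (Y : BanachSeqLattice) (S : X →ₗ[ℝ] E) (K : ℝ) : Prop :=
  ∀ (n : ℕ) (x : Fin n → X), vecNorm Y (fun i => S (x i)) ≤ K * tauNorm Y x

/-- `S : X → E` is `Y`-concave. -/
def IsYConcave (Y : BanachSeqLattice) (S : X →ₗ[ℝ] E) : Prop :=
  ∃ K : ℝ, 0 < K ∧ ConcaveBound Y S K

/-- The `Y`-concavity constant `‖S‖_{K_Y}` (for a `Y`-concave `S`): the smallest admissible
constant. -/
def concaveConst (Y : BanachSeqLattice) (S : X →ₗ[ℝ] E) : ℝ :=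
  sInf {K : ℝ | 0 ≤ K ∧ ConcaveBound Y S K}

end ConvexConcave

/-- The sequences that vanish from some index on. -/
def EventuallyZero {V : Type*} [Zero V] (w : ℕ → V) : Prop := ∃ N, ∀ j ≥ N, w j = 0

section SequenceSpaces

/-- The space `ℓ^Y(E)` of the sequences `w` in `E` with `(‖w_j‖)_j ∈ Y`. -/
def ellY (Y : BanachSeqLattice) (E : Type*) [NormedAddCommGroup E] : Set (ℕ → E) :=
  {w | (fun j => ‖w j‖) ∈ Y.carrier}

/-- The norm of `ℓ^Y(E)`. -/
def ellYNorm {E : Type*} [NormedAddCommGroup E] (Y : BanachSeqLattice) (w : ℕ → E) : ℝ :=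
  Y.nrm (fun j => ‖w j‖)

/-- `ℓ_0^Y(E)`, the closure in `ℓ^Y(E)` of the eventually zero sequences of `ℓ^Y(E)`. -/
def ellYZero (Y : BanachSeqLattice) (E : Type*) [NormedAddCommGroup E] : Set (ℕ → E) :=
  {w | w ∈ ellY Y E ∧ ∀ ε > 0, ∃ v ∈ ellY Y E, EventuallyZero v ∧ ellYNorm Y (w - v) < ε}

/-- The space `ℓ^{τ,Y}(X)` of the sequences `x` in `X` with `sup_n ‖(x_1, …, x_n)‖_{X^n,Y,τ} < ∞`. -/
def ellTau (Y : BanachSeqLattice) (X : Type*) [NormedAddCommGroup X] [NormedSpace ℝ X] [Lattice X] :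
    Set (ℕ → X) :=
  {x | BddAbove (Set.range fun n : ℕ => tauNorm Y (fun i : Fin n => x i))}

/-- The norm of `ℓ^{τ,Y}(X)`. -/
def ellTauNorm {X : Type*} [NormedAddCommGroup X] [NormedSpace ℝ X] [Lattice X]
    (Y : BanachSeqLattice) (x : ℕ → X) : ℝ :=
  ⨆ n : ℕ, tauNorm Y (fun i : Fin n => x i)

/-- `ℓ_0^{τ,Y}(X)`, the closure in `ℓ^{τ,Y}(X)` of the eventually zero sequences of
`ℓ^{τ,Y}(X)`. -/
def ellTauZero (Y : BanachSeqLattice) (X : Type*) [NormedAddCommGroup X] [NormedSpace ℝ X]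
    [Lattice X] : Set (ℕ → X) :=
  {x | x ∈ ellTau Y X ∧ ∀ ε > 0, ∃ v ∈ ellTau Y X, EventuallyZero v ∧ ellTauNorm Y (x - v) < ε}

end SequenceSpaces

/-- The associated operator `{w_j} ↦ {T w_j}` between spaces of all sequences. -/
def assocOp {V W : Type*} [AddCommGroup V] [Module ℝ V] [AddCommGroup W] [Module ℝ W]
    (T : V →ₗ[ℝ] W) : (ℕ → V) →ₗ[ℝ] (ℕ → W) :=
  T.compLeft ℕ

/-- `R` maps `A` into `B` and is a bounded operator from `(A, p)` to `(B, q)`. -/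
def IsBoundedOp {V W : Type*} (A : Set V) (p : V → ℝ) (B : Set W) (q : W → ℝ) (R : V → W) : Prop :=
  (∀ v ∈ A, R v ∈ B) ∧ ∃ C : ℝ, ∀ v ∈ A, q (R v) ≤ C * p v

/-- The operator norm of a bounded operator `R` from `(A, p)` to a space normed by `q`. -/
def opNormOn {V W : Type*} (A : Set V) (p : V → ℝ) (q : W → ℝ) (R : V → W) : ℝ :=
  sInf {C : ℝ | 0 ≤ C ∧ ∀ v ∈ A, q (R v) ≤ C * p v}

end

/-! Convexity and concavity are inequalities for finite tuples, that is, for eventually zero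
sequences; the content is their passage to the closures. This needs `tauNorm` to grow with the
tuple, to ignore appended zeros and to satisfy the triangle inequality. All three follow from the
composition rule `krivine_comp`, itself a consequence of the uniqueness of Krivine's calculus.

Existence and uniqueness of the calculus are proved by closing a graph. In `C(ℝ^n) × X`, take the
sublattice generated by the pairs (projection, `x j`). By `snd_nonneg_of_mem_latticeGraph`, a
nonnegative first coordinate forces a nonnegative second one, so the second coordinate is controlled
by the first. By Stone–Weierstrass on the `ℓ^1` sphere the first coordinates are dense in `H_n`, and
completeness of `X` extends the map.

For (i), solidity of `Y` bounds every truncation, so the estimate holds on all of `ℓ^Y(E)`. For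
(ii), approximation by eventually zero sequences gives a Cauchy sequence in `Y`, whose limit is
identified coordinatewise. In both parts the constants admissible for tuples and for sequences
coincide, and so do their infima. -/

noncomputable section

/-! ### Generated vector sublattices, and a separation lemma. -/

section VectorLattice

variable {P : Type*} [AddCommGroup P] [Module ℝ P] [Lattice P] [IsOrderedModule ℝ P]

theorem smul_sup_of_nonneg {c : ℝ} (hc : 0 ≤ c) (a b : P) : c • (a ⊔ b) = c • a ⊔ c • b := by
  rcases hc.eq_or_lt with rfl | hc
  · simp
  · exact (OrderIso.smulRight hc).map_sup a b

theorem smul_inf_of_nonneg {c : ℝ} (hc : 0 ≤ c) (a b : P) : c • (a ⊓ b) = c • a ⊓ c • b := by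
  rcases hc.eq_or_lt with rfl | hc
  · simp
  · exact (OrderIso.smulRight hc).map_inf a b

variable [IsOrderedAddMonoid P]

/-- The vector sublattice generated by a linear subspace. -/
def latticeSpan (S : Submodule ℝ P) : Submodule ℝ P where
  carrier := latticeClosure (S : Set P)
  zero_mem' := subset_latticeClosure S.zero_mem
  add_mem' := by
    -- `latticeClosure_min` serves as induction on membership, one summand at a time: translations
    -- preserve suprema and infima.
    have h₁ : ∀ s ∈ S, latticeClosure (S : Set P) ⊆ {b | s + b ∈ latticeClosure (S : Set P)} := by
      intro s hs
      refine latticeClosure_min (fun b hb => subset_latticeClosure (S.add_mem hs hb))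
        ⟨fun b hb c hc => ?_, fun b hb c hc => ?_⟩
      · simpa [add_sup] using isSublattice_latticeClosure.supClosed hb hc
      · simpa [add_inf] using isSublattice_latticeClosure.infClosed hb hc
    have h₂ : latticeClosure (S : Set P) ⊆
        {a | ∀ b ∈ latticeClosure (S : Set P), a + b ∈ latticeClosure (S : Set P)} := by
      refine latticeClosure_min (fun a ha b hb => h₁ a ha hb)
        ⟨fun a ha c hc b hb => ?_, fun a ha c hc b hb => ?_⟩
      · simpa [sup_add] using isSublattice_latticeClosure.supClosed (ha b hb) (hc b hb)
      · simpa [inf_add] using isSublattice_latticeClosure.infClosed (ha b hb) (hc b hb)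
    exact fun {a b} ha hb => h₂ ha b hb
  smul_mem' := by
    have h₁ : ∀ c : ℝ, 0 ≤ c →
        latticeClosure (S : Set P) ⊆ {b | c • b ∈ latticeClosure (S : Set P)} := by
      intro c h0
      refine latticeClosure_min (fun b hb => subset_latticeClosure (S.smul_mem c hb))
        ⟨fun a ha b hb => ?_, fun a ha b hb => ?_⟩
      · simpa [smul_sup_of_nonneg h0] using isSublattice_latticeClosure.supClosed ha hb
      · simpa [smul_inf_of_nonneg h0] using isSublattice_latticeClosure.infClosed ha hb
    have h₂ : latticeClosure (S : Set P) ⊆ {b | -b ∈ latticeClosure (S : Set P)} := by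
      refine latticeClosure_min (fun b hb => subset_latticeClosure (S.neg_mem hb))
        ⟨fun a ha b hb => ?_, fun a ha b hb => ?_⟩
      · simpa [neg_sup] using isSublattice_latticeClosure.infClosed ha hb
      · simpa [neg_inf] using isSublattice_latticeClosure.supClosed ha hb
    intro c a ha
    rcases le_total 0 c with hc | hc
    · exact h₁ c hc ha
    · have := h₁ (-c) (neg_nonneg.mpr hc) (h₂ ha)
      simpa using this

theorem subset_latticeSpan {S : Submodule ℝ P} {a : P} (ha : a ∈ S) : a ∈ latticeSpan S :=
  subset_latticeClosure ha

theorem sup_mem_latticeSpan {S : Submodule ℝ P} {a b : P} (ha : a ∈ latticeSpan S)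
    (hb : b ∈ latticeSpan S) : a ⊔ b ∈ latticeSpan S :=
  isSublattice_latticeClosure.supClosed ha hb

theorem inf_mem_latticeSpan {S : Submodule ℝ P} {a b : P} (ha : a ∈ latticeSpan S)
    (hb : b ∈ latticeSpan S) : a ⊓ b ∈ latticeSpan S :=
  isSublattice_latticeClosure.infClosed ha hb

theorem abs_mem_latticeSpan {S : Submodule ℝ P} {a : P} (ha : a ∈ latticeSpan S) :
    |a| ∈ latticeSpan S :=
  sup_mem_latticeSpan ha (Submodule.neg_mem _ ha)

/-- Every element of the vector sublattice generated by `S` is a finite infimum of finite suprema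
of elements of `S`. -/
theorem latticeSpan_subset_infClosure (S : Submodule ℝ P) :
    (latticeSpan S : Set P) ⊆ infClosure (supClosure (S : Set P)) := by
  -- A lattice-ordered group is distributive, so infima of suprema already form a sublattice.
  let _ : DistribLattice P := AddCommGroup.toDistribLattice P
  exact (infClosure_supClosure (S : Set P)).ge

end VectorLattice

/-- Otherwise a functional is strictly positive on the hull, and minus its coefficient vector is a
`t` at which every sum is negative. -/
theorem zero_mem_convexHull_of_forall_exists {n : ℕ} {s : Finset (Fin n → ℝ)}
    (h : ∀ t : Fin n → ℝ, ∃ a ∈ s, 0 ≤ ∑ j, a j * t j) :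
    (0 : Fin n → ℝ) ∈ convexHull ℝ (s : Set (Fin n → ℝ)) := by
  by_contra h0
  obtain ⟨f, u, hu, hf⟩ := geometric_hahn_banach_point_closed (convex_convexHull ℝ _)
    (s.finite_toSet.isCompact_convexHull ℝ).isClosed h0
  obtain ⟨a, ha, h⟩ := h fun j => -f (Pi.single j 1)
  have h1 := hf a (subset_convexHull ℝ _ ha)
  have h2 : f a = ∑ j, a j * f (Pi.single j 1) := by
    conv_lhs => rw [pi_eq_sum_univ' a]
    simp [map_sum]
  simp only [mul_neg, Finset.sum_neg_distrib, ← h2] at h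
  simp at hu
  linarith

/-! ### The lattice generated by the coordinates: positivity and density. -/

section Generated

variable {X : Type*} [NormedAddCommGroup X] [NormedSpace ℝ X] {n : ℕ}

instance : IsOrderedModule ℝ C(Fin n → ℝ, ℝ) where
  smul_le_smul_of_nonneg_left _ hc _ _ h t := mul_le_mul_of_nonneg_left (h t) hc
  smul_le_smul_of_nonneg_right _ hf _ _ h t := mul_le_mul_of_nonneg_right h (hf t)

/-- A linear form on `ℝ^n` paired with the corresponding linear combination of the `x_j`. -/
def linPair (x : Fin n → X) : (Fin n → ℝ) →ₗ[ℝ] C(Fin n → ℝ, ℝ) × X :=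
  Fintype.linearCombination ℝ fun j => ((HomogFun.proj j).1, x j)

theorem linPair_fst (x : Fin n → X) (a t : Fin n → ℝ) : (linPair x a).1 t = ∑ j, a j * t j := by
  simp [linPair, Fintype.linearCombination_apply, Prod.fst_sum, HomogFun.proj]

variable [Lattice X] [IsOrderedAddMonoid X] [IsOrderedModule ℝ X]

instance : IsOrderedModule ℝ (C(Fin n → ℝ, ℝ) × X) where
  smul_le_smul_of_nonneg_left _ hc _ _ h :=
    ⟨smul_le_smul_of_nonneg_left h.1 hc, smul_le_smul_of_nonneg_left h.2 hc⟩
  smul_le_smul_of_nonneg_right _ hf _ _ h :=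
    ⟨smul_le_smul_of_nonneg_right h hf.1, smul_le_smul_of_nonneg_right h hf.2⟩

/-- The graph of the calculus on the lattice generated by the coordinates. -/
def latticeGraph (x : Fin n → X) : Submodule ℝ (C(Fin n → ℝ, ℝ) × X) :=
  latticeSpan (LinearMap.range (linPair x))

/-- A maximum of linear forms that is nonnegative everywhere leaves no point where all forms are
negative, so some convex combination of the forms is zero. The same combination in `X` is zero and
lies below the supremum. -/
theorem snd_nonneg_of_mem_supClosure {x : Fin n → X} {p : C(Fin n → ℝ, ℝ) × X}
    (hp : p ∈ supClosure (LinearMap.range (linPair x) : Set (C(Fin n → ℝ, ℝ) × X)))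
    (h0 : 0 ≤ p.1) : 0 ≤ p.2 := by
  classical
  obtain ⟨T, hT, hTs, rfl⟩ := hp
  obtain ⟨s, -, hs⟩ := Finset.subset_set_image_iff.mp
    (show (T : Set _) ⊆ linPair x '' Set.univ by rwa [Set.image_univ, ← LinearMap.coe_range])
  have hle : ∀ a ∈ s, linPair x a ≤ T.sup' hT id := fun a ha =>
    Finset.le_sup' id (hs ▸ Finset.mem_image_of_mem _ ha)
  have hc : (0 : Fin n → ℝ) ∈ convexHull ℝ (s : Set (Fin n → ℝ)) := by
    refine zero_mem_convexHull_of_forall_exists fun t => ?_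
    by_contra! hneg
    have key : ∀ q : C(Fin n → ℝ, ℝ) × X, q = T.sup' hT id → q.1 t < 0 := by
      rintro _ rfl
      refine Finset.sup'_induction (p := fun q : C(Fin n → ℝ, ℝ) × X => q.1 t < 0) hT id
        (fun a ha b hb => ?_) fun q hq => ?_
      · exact max_lt ha hb
      · rw [← hs, Finset.mem_image] at hq
        obtain ⟨a, ha, rfl⟩ := hq
        simpa [linPair_fst] using hneg a ha
    exact (key _ rfl).not_ge (h0 t)
  obtain ⟨w, hw0, hw1, hw⟩ := Finset.mem_convexHull'.mp hc
  calc (0 : X) = (linPair x (∑ a ∈ s, w a • a)).2 := by rw [hw]; simp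
    _ = ∑ a ∈ s, w a • (linPair x a).2 := by simp [map_sum, Prod.snd_sum]
    _ ≤ ∑ a ∈ s, w a • (T.sup' hT id).2 :=
      Finset.sum_le_sum fun a ha => smul_le_smul_of_nonneg_left (hle a ha).2 (hw0 a ha)
    _ = (T.sup' hT id).2 := by rw [← Finset.sum_smul, hw1, one_smul]

/-- An infimum is nonnegative exactly when each of its members is, which reduces the claim to
suprema. -/
theorem snd_nonneg_of_mem_latticeGraph {x : Fin n → X} {p : C(Fin n → ℝ, ℝ) × X}
    (hp : p ∈ latticeGraph x) (h0 : 0 ≤ p.1) : 0 ≤ p.2 := by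
  obtain ⟨T, hT, hTs, rfl⟩ := latticeSpan_subset_infClosure _ hp
  have : ∀ q ∈ T, 0 ≤ q.2 := fun q hq =>
    snd_nonneg_of_mem_supClosure (hTs hq) (h0.trans (Finset.inf'_le id hq).1)
  exact Finset.inf'_induction (p := fun q : C(Fin n → ℝ, ℝ) × X => 0 ≤ q.2) hT id
    (fun a ha b hb => le_inf ha hb) this

theorem fst_mem_homogFun {x : Fin n → X} {p : C(Fin n → ℝ, ℝ) × X}
    (hp : p ∈ latticeGraph x) : p.1 ∈ HomogFun n := by
  refine latticeClosure_min (t := {p | p.1 ∈ HomogFun n}) ?_ ⟨?_, ?_⟩ hp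
  · rintro _ ⟨a, rfl⟩ c hc t
    simp [linPair_fst, Finset.mul_sum, mul_left_comm]
  · intro p hp q hq
    exact (HomogFun.sup ⟨p.1, hp⟩ ⟨q.1, hq⟩).2
  · intro p hp q hq c hc t
    change min (p.1 _) (q.1 _) = c * min (p.1 t) (q.1 t)
    rw [hp c hc t, hq c hc t, mul_min_of_nonneg _ _ hc]

/-- The `ℓ^1`-norm on `ℝ^n`, as an element of `H_n`. -/
def HomogFun.sumAbs (n : ℕ) : HomogFun n :=
  ⟨⟨fun t => ∑ j, |t j|, by fun_prop⟩, fun c hc t => by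
    simp [abs_mul, abs_of_nonneg hc, Finset.mul_sum]⟩

theorem HomogFun.sumAbs_apply (t : Fin n → ℝ) : (HomogFun.sumAbs n).1 t = ∑ j, |t j| := rfl

theorem HomogFun.sumAbs_nonneg (t : Fin n → ℝ) : 0 ≤ (HomogFun.sumAbs n).1 t := by
  rw [sumAbs_apply]
  positivity

theorem proj_mem_latticeGraph (x : Fin n → X) (j : Fin n) :
    ((HomogFun.proj j).1, x j) ∈ latticeGraph x :=
  subset_latticeSpan ⟨Pi.single j 1, by simp [linPair, Fintype.linearCombination_apply_single]⟩

theorem sumAbs_mem_latticeGraph (x : Fin n → X) :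
    ((HomogFun.sumAbs n).1, ∑ j, |x j|) ∈ latticeGraph x := by
  have h : ∑ j, |(((HomogFun.proj j).1, x j) : C(Fin n → ℝ, ℝ) × X)| ∈ latticeGraph x :=
    Submodule.sum_mem _ fun j _ => abs_mem_latticeSpan (proj_mem_latticeGraph x j)
  convert h using 1
  refine Prod.ext ?_ ?_
  · ext t
    rw [Prod.fst_sum, ContinuousMap.sum_apply]
    rfl
  · rw [Prod.snd_sum]
    rfl

/-- Positivity applied to `ε` times the `ℓ^1` pair, plus or minus `p`. This is the continuity that
makes the closed graph single-valued. -/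
theorem abs_snd_le_of_mem_latticeGraph {x : Fin n → X} {p : C(Fin n → ℝ, ℝ) × X}
    (hp : p ∈ latticeGraph x) {ε : ℝ} (h : ∀ t, |p.1 t| ≤ ε * (HomogFun.sumAbs n).1 t) :
    |p.2| ≤ ε • ∑ j, |x j| := by
  have hu := Submodule.smul_mem _ ε (sumAbs_mem_latticeGraph x)
  refine abs_le'.mpr ⟨?_, ?_⟩
  · have := snd_nonneg_of_mem_latticeGraph (Submodule.sub_mem _ hu hp) fun t => by
      simpa using (abs_le.mp (h t)).2
    simpa using this
  · have := snd_nonneg_of_mem_latticeGraph (Submodule.add_mem _ hu hp) fun t => by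
      have := (abs_le.mp (h t)).1
      simp
      linarith
    have := neg_le_iff_add_nonneg.mpr this
    simpa using this

theorem norm_snd_le_of_mem_latticeGraph [HasSolidNorm X] {x : Fin n → X}
    {p : C(Fin n → ℝ, ℝ) × X} (hp : p ∈ latticeGraph x) {ε : ℝ} (hε : 0 ≤ ε)
    (h : ∀ t, |p.1 t| ≤ ε * (HomogFun.sumAbs n).1 t) : ‖p.2‖ ≤ ε * ‖∑ j, |x j|‖ := by
  have := norm_le_norm_of_abs_le_abs ((abs_snd_le_of_mem_latticeGraph hp h).trans (le_abs_self _))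
  rwa [norm_smul, Real.norm_of_nonneg hε] at this

theorem isCompact_sumAbs_eq_one (n : ℕ) :
    IsCompact {t : Fin n → ℝ | (HomogFun.sumAbs n).1 t = 1} := by
  refine Metric.isCompact_of_isClosed_isBounded
    (isClosed_singleton.preimage (HomogFun.sumAbs n).1.continuous)
    ((Metric.isBounded_closedBall (x := (0 : Fin n → ℝ)) (r := 1)).subset fun t ht => ?_)
  rw [mem_closedBall_zero_iff, pi_norm_le_iff_of_nonneg zero_le_one]
  intro j
  exact (Finset.single_le_sum (f := fun j => |t j|) (fun _ _ => abs_nonneg _)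
    (Finset.mem_univ j)).trans_eq ht

/-- The lattice generated by the coordinates is dense in `H_n`. -/
theorem exists_mem_latticeGraph_approx (x : Fin n → X) (f : HomogFun n) {ε : ℝ} (hε : 0 < ε) :
    ∃ p ∈ latticeGraph x, ∀ t, |f.1 t - p.1 t| ≤ ε * (HomogFun.sumAbs n).1 t := by
  -- Homogeneous functions are determined by this compact sphere, where the `ℓ^1`-norm plays the
  -- role of the constant `1`.
  set S := {t : Fin n → ℝ | (HomogFun.sumAbs n).1 t = 1} with hS
  have : CompactSpace S := isCompact_iff_compactSpace.mp (isCompact_sumAbs_eq_one n)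
  have hdense := ContinuousMap.sublattice_closure_eq_top
    ((fun p : C(Fin n → ℝ, ℝ) × X => p.1.restrict S) '' (latticeGraph x : Set _))
    ⟨_, Set.mem_image_of_mem _ (latticeGraph x).zero_mem⟩
    (by
      rintro _ ⟨p, hp, rfl⟩ _ ⟨q, hq, rfl⟩
      exact ⟨p ⊓ q, inf_mem_latticeSpan hp hq, rfl⟩)
    (by
      rintro _ ⟨p, hp, rfl⟩ _ ⟨q, hq, rfl⟩
      exact ⟨p ⊔ q, sup_mem_latticeSpan hp hq, rfl⟩)
    (by
      intro v s t
      by_cases hst : s = t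
      · subst hst
        refine ⟨_, ⟨_, Submodule.smul_mem _ (v s) (sumAbs_mem_latticeGraph x), rfl⟩, ?_, ?_⟩ <;>
          simp [show (HomogFun.sumAbs n).1 s = 1 from s.2]
      · obtain ⟨j, hj⟩ := Function.ne_iff.mp fun h => hst (Subtype.ext h)
        have hj' : (s : Fin n → ℝ) j - (t : Fin n → ℝ) j ≠ 0 := sub_ne_zero.mpr hj
        -- Two-point interpolation by an affine function of the `j`-th coordinate, with slope `b`.
        set b := (v s - v t) / ((s : Fin n → ℝ) j - (t : Fin n → ℝ) j)
        have hb : b * ((s : Fin n → ℝ) j - (t : Fin n → ℝ) j) = v s - v t := div_mul_cancel₀ _ hj'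
        refine ⟨_, ⟨_, Submodule.add_mem _
          (Submodule.smul_mem _ (v s - b * (s : Fin n → ℝ) j) (sumAbs_mem_latticeGraph x))
          (Submodule.smul_mem _ b (proj_mem_latticeGraph x j)), rfl⟩, ?_, ?_⟩
        · simp [show (HomogFun.sumAbs n).1 s = 1 from s.2, HomogFun.proj]
        · simp [show (HomogFun.sumAbs n).1 t = 1 from t.2, HomogFun.proj]
          linarith)
  have hf : f.1.restrict S ∈ closure
      ((fun p : C(Fin n → ℝ, ℝ) × X => p.1.restrict S) '' (latticeGraph x : Set _)) := by
    rw [hdense]; trivial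
  obtain ⟨_, ⟨p, hp, rfl⟩, hd⟩ := Metric.mem_closure_iff.mp hf ε hε
  refine ⟨p, hp, fun t => ?_⟩
  have hh : ∀ c : ℝ, 0 ≤ c → ∀ s, |f.1 (c • s) - p.1 (c • s)| = c * |f.1 s - p.1 s| := by
    intro c hc s
    rw [f.2 c hc s, fst_mem_homogFun hp c hc s, ← mul_sub, abs_mul, abs_of_nonneg hc]
  set r := (HomogFun.sumAbs n).1 t
  rcases (HomogFun.sumAbs_nonneg t).eq_or_lt with h0 | h0
  · have ht : t = 0 := by
      ext j
      rw [HomogFun.sumAbs_apply, eq_comm,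
        Finset.sum_eq_zero_iff_of_nonneg fun j _ => abs_nonneg (t j)] at h0
      have := h0 j (Finset.mem_univ j)
      simpa using this
    have := hh 0 le_rfl 0
    simp only [zero_smul, zero_mul] at this
    rw [ht, this]
    exact mul_nonneg hε.le (HomogFun.sumAbs_nonneg _)
  · have hmem : r⁻¹ • t ∈ S := by
      rw [hS, Set.mem_ofPred_eq, (HomogFun.sumAbs n).2 _ (inv_nonneg.mpr h0.le)]
      exact inv_mul_cancel₀ h0.ne'
    have h1 : |f.1 (r⁻¹ • t) - p.1 (r⁻¹ • t)| ≤ ε := by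
      have := (ContinuousMap.dist_apply_le_dist (f := f.1.restrict S) (g := p.1.restrict S)
        ⟨_, hmem⟩).trans hd.le
      simpa [Real.dist_eq] using this
    have h2 : t = r • (r⁻¹ • t) := (smul_inv_smul₀ h0.ne' t).symm
    rw [h2, hh r h0.le, mul_comm ε]
    exact mul_le_mul_of_nonneg_left h1 h0.le

end Generated

/-! ### Existence of Krivine's calculus. -/

section Existence

variable {X : Type*} [NormedAddCommGroup X] [NormedSpace ℝ X] [Lattice X] [IsOrderedAddMonoid X]
  [IsOrderedModule ℝ X] {n : ℕ} {x : Fin n → X}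

/-- `(f, y)` is a limit of elements of `latticeGraph x`. -/
def IsGraphLimit (x : Fin n → X) (f : HomogFun n) (y : X) : Prop :=
  ∀ ε > 0, ∃ p ∈ latticeGraph x,
    (∀ t, |f.1 t - p.1 t| ≤ ε * (HomogFun.sumAbs n).1 t) ∧ ‖y - p.2‖ ≤ ε

theorem isGraphLimit_of_mem {f : HomogFun n} {y : X} (h : (f.1, y) ∈ latticeGraph x) :
    IsGraphLimit x f y := fun ε hε =>
  ⟨_, h, fun t => by simpa using mul_nonneg hε.le (HomogFun.sumAbs_nonneg t), by simpa using hε.le⟩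

namespace IsGraphLimit

theorem add {f g : HomogFun n} {y z : X} (hf : IsGraphLimit x f y) (hg : IsGraphLimit x g z) :
    IsGraphLimit x (f + g) (y + z) := by
  intro ε hε
  obtain ⟨p, hp, hp₁, hp₂⟩ := hf (ε / 2) (half_pos hε)
  obtain ⟨q, hq, hq₁, hq₂⟩ := hg (ε / 2) (half_pos hε)
  refine ⟨p + q, Submodule.add_mem _ hp hq, fun t => ?_, ?_⟩
  · have h := abs_add_le (f.1 t - p.1 t) (g.1 t - q.1 t)
    rw [sub_add_sub_comm] at h
    change |f.1 t + g.1 t - (p.1 t + q.1 t)| ≤ _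
    linarith [hp₁ t, hq₁ t]
  · have h := norm_add_le (y - p.2) (z - q.2)
    rw [sub_add_sub_comm] at h
    change ‖y + z - (p.2 + q.2)‖ ≤ _
    linarith

theorem smul {f : HomogFun n} {y : X} (hf : IsGraphLimit x f y) (c : ℝ) :
    IsGraphLimit x (c • f) (c • y) := by
  intro ε hε
  have hc : 0 < |c| + 1 := by positivity
  obtain ⟨p, hp, hp₁, hp₂⟩ := hf (ε / (|c| + 1)) (div_pos hε hc)
  have hle : |c| * (ε / (|c| + 1)) ≤ ε := by
    rw [mul_div_assoc', div_le_iff₀ hc]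
    nlinarith
  refine ⟨c • p, Submodule.smul_mem _ c hp, fun t => ?_, ?_⟩
  · change |c * f.1 t - c * p.1 t| ≤ _
    rw [← mul_sub, abs_mul]
    calc _ ≤ |c| * (ε / (|c| + 1) * (HomogFun.sumAbs n).1 t) :=
          mul_le_mul_of_nonneg_left (hp₁ t) (abs_nonneg c)
      _ = |c| * (ε / (|c| + 1)) * (HomogFun.sumAbs n).1 t := (mul_assoc _ _ _).symm
      _ ≤ _ := mul_le_mul_of_nonneg_right hle (HomogFun.sumAbs_nonneg t)
  · change ‖c • y - c • p.2‖ ≤ _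
    rw [← smul_sub, norm_smul, Real.norm_eq_abs]
    exact (mul_le_mul_of_nonneg_left hp₂ (abs_nonneg c)).trans hle

variable [HasSolidNorm X]

theorem sup {f g : HomogFun n} {y z : X} (hf : IsGraphLimit x f y) (hg : IsGraphLimit x g z) :
    IsGraphLimit x (HomogFun.sup f g) (y ⊔ z) := by
  intro ε hε
  obtain ⟨p, hp, hp₁, hp₂⟩ := hf (ε / 2) (half_pos hε)
  obtain ⟨q, hq, hq₁, hq₂⟩ := hg (ε / 2) (half_pos hε)
  refine ⟨p ⊔ q, sup_mem_latticeSpan hp hq, fun t => ?_, ?_⟩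
  · change |max (f.1 t) (g.1 t) - max (p.1 t) (q.1 t)| ≤ _
    refine (abs_max_sub_max_le_max _ _ _ _).trans (max_le ((hp₁ t).trans ?_) ((hq₁ t).trans ?_)) <;>
      exact mul_le_mul_of_nonneg_right (half_le_self hε.le) (HomogFun.sumAbs_nonneg t)
  · change ‖y ⊔ z - p.2 ⊔ q.2‖ ≤ _
    linarith [norm_sup_sub_sup_le_add_norm y z p.2 q.2]

/-- An approximating pair has a small first coordinate, hence a small second one; in `M`, the `1`
pays for `‖y - p.2‖` and the other term for `‖p.2‖`. -/
theorem eq_zero {y : X} (h : IsGraphLimit x 0 y) : y = 0 := by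
  rw [← norm_le_zero_iff]
  set M := 1 + ‖∑ j, |x j|‖ with hM
  have hM0 : 0 < M := by positivity
  refine le_of_forall_pos_le_add fun ε hε => ?_
  obtain ⟨p, hp, hp₁, hp₂⟩ := h (ε / M) (div_pos hε hM0)
  have h₁ := norm_snd_le_of_mem_latticeGraph hp (div_pos hε hM0).le fun t => by
    simpa using hp₁ t
  calc ‖y‖ ≤ ‖y - p.2‖ + ‖p.2‖ := by simpa using norm_add_le (y - p.2) p.2
    _ ≤ ε / M * M := by rw [hM, mul_add, ← hM]; linarith
    _ = 0 + ε := by rw [div_mul_cancel₀ _ hM0.ne', zero_add]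

theorem unique {f : HomogFun n} {y z : X} (hy : IsGraphLimit x f y) (hz : IsGraphLimit x f z) :
    y = z := by
  have h := hy.add (hz.smul (-1))
  rw [neg_one_smul ℝ z, neg_one_smul ℝ f, add_neg_cancel, ← sub_eq_add_neg] at h
  exact sub_eq_zero.mp h.eq_zero

end IsGraphLimit

/-- Approximants of `f` differ by little in the first coordinate, so their second coordinates form a
Cauchy sequence in `X`. -/
theorem exists_isGraphLimit [HasSolidNorm X] [CompleteSpace X] (x : Fin n → X) (f : HomogFun n) :
    ∃ y, IsGraphLimit x f y := by
  choose p hp hpf using fun m : ℕ =>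
    exists_mem_latticeGraph_approx x f (Nat.one_div_pos_of_nat (n := m) (α := ℝ))
  have hanti : ∀ {N m : ℕ}, N ≤ m → 1 / ((m : ℝ) + 1) ≤ 1 / ((N : ℝ) + 1) := fun h =>
    Nat.one_div_le_one_div h
  set u := ‖∑ j, |x j|‖
  have hlim : Filter.Tendsto (fun N : ℕ => 2 * (1 / ((N : ℝ) + 1)) * u) Filter.atTop (nhds 0) := by
    simpa using (tendsto_one_div_add_atTop_nhds_zero_nat.const_mul (2 : ℝ)).mul_const u
  have hc : CauchySeq fun m => (p m).2 := by
    refine cauchySeq_of_le_tendsto_0 _ (fun m k N hm hk => ?_) hlim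
    rw [dist_eq_norm]
    refine norm_snd_le_of_mem_latticeGraph (Submodule.sub_mem _ (hp m) (hp k)) (by positivity)
      fun t => ?_
    have h₀ := HomogFun.sumAbs_nonneg t
    have h₁ := (hpf m t).trans (mul_le_mul_of_nonneg_right (hanti hm) h₀)
    have h₂ := (hpf k t).trans (mul_le_mul_of_nonneg_right (hanti hk) h₀)
    have h₃ := abs_sub_le ((p m).1 t) (f.1 t) ((p k).1 t)
    rw [abs_sub_comm ((p m).1 t) (f.1 t)] at h₃
    change |(p m).1 t - (p k).1 t| ≤ _
    linarith
  obtain ⟨y, hy⟩ := cauchySeq_tendsto_of_complete hc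
  refine ⟨y, fun ε hε => ?_⟩
  have h₁ := Metric.tendsto_nhds.mp hy ε hε
  have h₂ := (tendsto_one_div_add_atTop_nhds_zero_nat (𝕜 := ℝ)).eventually (gt_mem_nhds hε)
  obtain ⟨m, hm₁, hm₂⟩ := (h₁.and h₂).exists
  refine ⟨p m, hp m, fun t => (hpf m t).trans
    (mul_le_mul_of_nonneg_right hm₂.le (HomogFun.sumAbs_nonneg t)), ?_⟩
  rw [← dist_eq_norm, dist_comm]
  exact hm₁.le

/-- Existence of Krivine's functional calculus in a Banach lattice. -/
theorem exists_isKrivineCalculus [HasSolidNorm X] [CompleteSpace X] (x : Fin n → X) :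
    ∃ τ : HomogFun n →ₗ[ℝ] X, IsKrivineCalculus x τ := by
  choose τ hτ using exists_isGraphLimit x
  exact ⟨{ toFun := τ
           map_add' := fun f g => (hτ _).unique ((hτ f).add (hτ g))
           map_smul' := fun c f => (hτ _).unique ((hτ f).smul c) },
    fun j => (hτ _).unique (isGraphLimit_of_mem (proj_mem_latticeGraph x j)),
    fun f g => (hτ _).unique ((hτ f).sup (hτ g))⟩

end Existence

/-! ### Uniqueness of Krivine's calculus. -/

namespace IsKrivineCalculus

variable {X : Type*} [NormedAddCommGroup X] [NormedSpace ℝ X] [Lattice X]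
  {n : ℕ} {x : Fin n → X} {τ σ : HomogFun n →ₗ[ℝ] X}

theorem monotone (hτ : IsKrivineCalculus x τ) {f g : HomogFun n} (h : ∀ t, f.1 t ≤ g.1 t) :
    τ f ≤ τ g := by
  have : HomogFun.sup f g = g := Subtype.ext (sup_eq_right.mpr h)
  rw [← this, hτ.map_sup]
  exact le_sup_left

theorem nonneg (hτ : IsKrivineCalculus x τ) {f : HomogFun n} (h : ∀ t, 0 ≤ f.1 t) : 0 ≤ τ f := by
  have := hτ.monotone (f := 0) (g := f) h
  rwa [map_zero] at this

theorem norm_le [HasSolidNorm X] (hτ : IsKrivineCalculus x τ) {f : HomogFun n} {ε : ℝ} (hε : 0 ≤ ε)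
    (h : ∀ t, |f.1 t| ≤ ε * (HomogFun.sumAbs n).1 t) : ‖τ f‖ ≤ ε * ‖τ (HomogFun.sumAbs n)‖ := by
  rw [← Real.norm_of_nonneg hε, ← norm_smul, ← map_smul]
  refine norm_le_norm_of_abs_le_abs (le_trans (abs_le'.mpr ⟨?_, ?_⟩) (le_abs_self _))
  · exact hτ.monotone fun t => (abs_le.mp (h t)).2
  · rw [← map_neg]
    exact hτ.monotone fun t => neg_le.mp (abs_le.mp (h t)).1

variable [IsOrderedAddMonoid X]

theorem map_inf (hτ : IsKrivineCalculus x τ) {f g h : HomogFun n} (hh : h.1 = f.1 ⊓ g.1) :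
    τ h = τ f ⊓ τ g := by
  have : h = -HomogFun.sup (-f) (-g) := Subtype.ext (by
    rw [hh]
    change _ = -(-f.1 ⊔ -g.1)
    rw [neg_sup, neg_neg, neg_neg])
  rw [this, map_neg, hτ.map_sup, map_neg, map_neg, neg_sup, neg_neg, neg_neg]

variable [IsOrderedModule ℝ X]

/-- The graph of `τ` is a sublattice containing the generators, hence contains everything they
generate. -/
theorem eq_of_mem_latticeGraph (hτ : IsKrivineCalculus x τ) {p : C(Fin n → ℝ, ℝ) × X}
    (hp : p ∈ latticeGraph x) (h : p.1 ∈ HomogFun n) : τ ⟨p.1, h⟩ = p.2 := by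
  suffices H : p ∈ {p : C(Fin n → ℝ, ℝ) × X | ∃ f : HomogFun n, f.1 = p.1 ∧ τ f = p.2} by
    obtain ⟨f, hf, hfp⟩ := H
    rw [← hfp]
    exact congrArg τ (Subtype.ext hf.symm)
  refine latticeClosure_min ?_ ⟨?_, ?_⟩ hp
  · rintro _ ⟨a, rfl⟩
    refine ⟨∑ j, a j • HomogFun.proj j, ?_, ?_⟩
    · simp [linPair, Fintype.linearCombination_apply, Prod.fst_sum]
    · simp [linPair, Fintype.linearCombination_apply, Prod.snd_sum, hτ.map_proj]
  · rintro p ⟨f, hf, hf'⟩ q ⟨g, hg, hg'⟩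
    refine ⟨HomogFun.sup f g, ?_, ?_⟩
    · change f.1 ⊔ g.1 = p.1 ⊔ q.1
      rw [hf, hg]
    · rw [hτ.map_sup, hf', hg']
      rfl
  · rintro p ⟨f, hf, hf'⟩ q ⟨g, hg, hg'⟩
    have hm : f.1 ⊓ g.1 ∈ HomogFun n := fun c hc t => by
      change min (f.1 _) (g.1 _) = c * min (f.1 t) (g.1 t)
      rw [f.2 c hc t, g.2 c hc t, mul_min_of_nonneg _ _ hc]
    refine ⟨⟨_, hm⟩, ?_, ?_⟩
    · change f.1 ⊓ g.1 = p.1 ⊓ q.1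
      rw [hf, hg]
    · rw [hτ.map_inf rfl, hf', hg']
      rfl

variable [HasSolidNorm X]

/-- Uniqueness of Krivine's functional calculus. -/
theorem unique (hτ : IsKrivineCalculus x τ) (hσ : IsKrivineCalculus x σ) : τ = σ := by
  ext f
  rw [← sub_eq_zero, ← norm_le_zero_iff]
  set M := 1 + (‖τ (HomogFun.sumAbs n)‖ + ‖σ (HomogFun.sumAbs n)‖) with hM
  have hM0 : 0 < M := by positivity
  refine le_of_forall_pos_le_add fun ε hε => ?_
  have hε' : 0 < ε / M := div_pos hε hM0
  obtain ⟨p, hp, hpf⟩ := exists_mem_latticeGraph_approx x f hε'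
  set g : HomogFun n := ⟨p.1, fst_mem_homogFun hp⟩
  -- Both calculi agree on `g`, so only the small remainder `f - g` contributes.
  have h : τ f - σ f = τ (f - g) - σ (f - g) := by
    rw [map_sub, map_sub, hτ.eq_of_mem_latticeGraph hp, hσ.eq_of_mem_latticeGraph hp]
    abel
  have h₁ := hτ.norm_le (f := f - g) hε'.le hpf
  have h₂ := hσ.norm_le (f := f - g) hε'.le hpf
  calc ‖τ f - σ f‖ ≤ ‖τ (f - g)‖ + ‖σ (f - g)‖ := h ▸ norm_sub_le _ _
    _ ≤ ε / M * M := by rw [hM, mul_add, mul_add, ← hM]; linarith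
    _ = 0 + ε := by rw [div_mul_cancel₀ _ hM0.ne', zero_add]

end IsKrivineCalculus

/-! ### The composition rule. -/

section Krivine

variable {X : Type*} [NormedAddCommGroup X] [NormedSpace ℝ X] [CompleteSpace X] [Lattice X]
  [IsOrderedAddMonoid X] [IsOrderedModule ℝ X] [HasSolidNorm X] {m n : ℕ}

theorem isKrivineCalculus_krivine (x : Fin n → X) : IsKrivineCalculus x (krivine x) := by
  have h := exists_isKrivineCalculus x
  rw [krivine, dif_pos h]
  exact h.choose_spec

/-- Composition of an element of `H_n` with a homogeneous continuous map `ℝ^m → ℝ^n`. -/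
def HomogFun.comp (A : C(Fin m → ℝ, Fin n → ℝ)) (hA : ∀ c : ℝ, 0 ≤ c → ∀ t, A (c • t) = c • A t) :
    HomogFun n →ₗ[ℝ] HomogFun m where
  toFun f := ⟨f.1.comp A, fun c hc t => by
    rw [ContinuousMap.comp_apply, hA c hc, f.2 c hc, ContinuousMap.comp_apply]⟩
  map_add' _ _ := rfl
  map_smul' _ _ := rfl

/-- As a function of `f`, the left side is a calculus for the images of the projections; uniqueness
identifies it. -/
theorem krivine_comp (x : Fin m → X) (A : C(Fin m → ℝ, Fin n → ℝ))
    (hA : ∀ c : ℝ, 0 ≤ c → ∀ t, A (c • t) = c • A t) (f : HomogFun n) :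
    krivine x (HomogFun.comp A hA f) =
      krivine (fun j => krivine x (HomogFun.comp A hA (HomogFun.proj j))) f := by
  have h : IsKrivineCalculus (fun j => krivine x (HomogFun.comp A hA (HomogFun.proj j)))
      (krivine x ∘ₗ HomogFun.comp A hA) :=
    ⟨fun _ => rfl, fun f g => (isKrivineCalculus_krivine x).map_sup
      (HomogFun.comp A hA f) (HomogFun.comp A hA g)⟩
  exact LinearMap.congr_fun (h.unique (isKrivineCalculus_krivine _)) f

theorem krivine_proj (x : Fin n → X) (j : Fin n) : krivine x (HomogFun.proj j) = x j :=
  (isKrivineCalculus_krivine x).map_proj j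

end Krivine

/-! ### Sequence lattices, padding and `ℓ^Y(E)`. -/

namespace BanachSeqLattice

variable (Y : BanachSeqLattice)

theorem nrm_zero : Y.nrm 0 = 0 := by
  simpa using Y.nrm_smul 0 0 Y.carrier.zero_mem

theorem nrm_nonneg {f : ℕ → ℝ} (hf : f ∈ Y.carrier) : 0 ≤ Y.nrm f := by
  rw [← Y.nrm_zero]
  exact Y.solid_nrm 0 f hf fun j => by simp

theorem nrm_single_pos (j : ℕ) : 0 < Y.nrm (Pi.single j 1) := by
  refine (Y.nrm_nonneg (Y.single_mem j)).lt_of_ne fun h => ?_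
  simpa using congrFun (Y.eq_zero_of_nrm _ (Y.single_mem j) h.symm) j

/-- Coordinates are continuous on `Y`; this later identifies a limit in `Y` with a coordinatewise
limit. -/
theorem abs_apply_mul_nrm_single_le {f : ℕ → ℝ} (hf : f ∈ Y.carrier) (j : ℕ) :
    |f j| * Y.nrm (Pi.single j 1) ≤ Y.nrm f := by
  rw [← Y.nrm_smul _ _ (Y.single_mem j)]
  refine Y.solid_nrm _ _ hf fun i => ?_
  by_cases h : i = j
  · subst h; simp
  · simp [h]

theorem nrm_sub_comm {f g : ℕ → ℝ} (hf : f ∈ Y.carrier) (hg : g ∈ Y.carrier) :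
    Y.nrm (f - g) = Y.nrm (g - f) := by
  rw [← neg_sub, ← neg_one_smul ℝ, Y.nrm_smul _ _ (Y.carrier.sub_mem hg hf)]
  simp

theorem finNorm_nonneg (n : ℕ) (t : Fin n → ℝ) : 0 ≤ Y.finNorm n t :=
  Y.nrm_nonneg (Y.padZero_mem n t)

theorem finNorm_sub_le (n : ℕ) (s t : Fin n → ℝ) :
    Y.finNorm n (s - t) ≤ Y.finNorm n s + Y.finNorm n t := by
  have h := Y.finNorm_add_le n s ((-1 : ℝ) • t)
  rw [Y.finNorm_smul, neg_one_smul, ← sub_eq_add_neg] at h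
  simpa using h

end BanachSeqLattice

theorem padZero_apply_of_lt {n : ℕ} (t : Fin n → ℝ) {j : ℕ} (h : j < n) :
    padZero n t j = t ⟨j, h⟩ := dif_pos h

theorem padZero_apply_of_le {n : ℕ} (t : Fin n → ℝ) {j : ℕ} (h : n ≤ j) :
    padZero n t j = 0 := dif_neg h.not_gt

/-- The sequence `(w_1, …, w_n, 0, 0, …)`. -/
def padSeq {V : Type*} [Zero V] {n : ℕ} (w : Fin n → V) (j : ℕ) : V :=
  if h : j < n then w ⟨j, h⟩ else 0

section PadSeq

variable {V : Type*} [Zero V] {n : ℕ} (w : Fin n → V)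

theorem padSeq_coe (i : Fin n) : padSeq w i = w i := dif_pos i.2

theorem padSeq_of_le {j : ℕ} (h : n ≤ j) : padSeq w j = 0 := dif_neg h.not_gt

theorem eventuallyZero_padSeq : EventuallyZero (padSeq w) := ⟨n, fun _ => padSeq_of_le w⟩

end PadSeq

section EllY

variable {E : Type*} [NormedAddCommGroup E] (Y : BanachSeqLattice)

theorem ellYNorm_nonneg {w : ℕ → E} (hw : w ∈ ellY Y E) : 0 ≤ ellYNorm Y w := Y.nrm_nonneg hw

theorem vecNorm_le_ellYNorm {w : ℕ → E} (hw : w ∈ ellY Y E) (n : ℕ) :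
    vecNorm Y (fun i : Fin n => w i) ≤ ellYNorm Y w := by
  refine Y.solid_nrm _ _ hw fun j => ?_
  rcases lt_or_ge j n with h | h
  · rw [padZero_apply_of_lt _ h]
  · simp [padZero_apply_of_le _ h]

theorem padZero_norm_eq {w : ℕ → E} {n : ℕ} (hw : ∀ j ≥ n, w j = 0) :
    padZero n (fun i => ‖w i‖) = fun j => ‖w j‖ := by
  ext j
  rcases lt_or_ge j n with h | h
  · rw [padZero_apply_of_lt _ h]
  · rw [padZero_apply_of_le _ h, hw j h, norm_zero]

theorem EventuallyZero.mem_ellY {w : ℕ → E} (hw : EventuallyZero w) : w ∈ ellY Y E := by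
  obtain ⟨n, hn⟩ := hw
  change (fun j => ‖w j‖) ∈ Y.carrier
  rw [← padZero_norm_eq hn]
  exact Y.padZero_mem n _

theorem ellYNorm_eq_vecNorm {w : ℕ → E} {n : ℕ} (hw : ∀ j ≥ n, w j = 0) :
    ellYNorm Y w = vecNorm Y (fun i : Fin n => w i) := by
  rw [ellYNorm, ← padZero_norm_eq hw]
  rfl

theorem ellYNorm_padSeq {n : ℕ} (w : Fin n → E) : ellYNorm Y (padSeq w) = vecNorm Y w := by
  rw [ellYNorm_eq_vecNorm Y fun _ => padSeq_of_le w]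
  simp only [padSeq_coe]

theorem sub_mem_ellY {v w : ℕ → E} (hv : v ∈ ellY Y E) (hw : w ∈ ellY Y E) :
    v - w ∈ ellY Y E := by
  refine Y.solid_mem _ _ (Y.carrier.add_mem hv hw) fun j => ?_
  rw [abs_norm]
  exact (norm_sub_le _ _).trans (le_abs_self _)

theorem mem_ellYZero_of_eventuallyZero {w : ℕ → E} (hw : EventuallyZero w) :
    w ∈ ellYZero Y E := by
  refine ⟨hw.mem_ellY Y, fun ε hε => ⟨w, hw.mem_ellY Y, hw, ?_⟩⟩
  have : (fun j => ‖(w - w) j‖) = 0 := by ext; simp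
  rwa [ellYNorm, this, Y.nrm_zero]

end EllY

/-! ### The norm of `ℓ^{τ,Y}(X)`. -/

section TauNorm

variable {X : Type*} [NormedAddCommGroup X] [NormedSpace ℝ X] [Lattice X]
  (Y : BanachSeqLattice)

theorem ellTauNorm_nonneg (x : ℕ → X) : 0 ≤ ellTauNorm Y x :=
  Real.iSup_nonneg fun _ => norm_nonneg _

theorem tauNorm_le_ellTauNorm {x : ℕ → X} (hx : x ∈ ellTau Y X) (n : ℕ) :
    tauNorm Y (fun i : Fin n => x i) ≤ ellTauNorm Y x :=
  le_ciSup (f := fun n : ℕ => tauNorm Y (fun i : Fin n => x i)) hx n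

variable [CompleteSpace X] [IsOrderedAddMonoid X] [IsOrderedModule ℝ X] [HasSolidNorm X]

/-- With `A` the truncation, both norms are read in the calculus of the longer tuple, where solidity
of `Y` compares them. -/
theorem tauNorm_mono (x : ℕ → X) {m n : ℕ} (h : m ≤ n) :
    tauNorm Y (fun i : Fin m => x i) ≤ tauNorm Y (fun i : Fin n => x i) := by
  let A : C(Fin n → ℝ, Fin m → ℝ) := ⟨fun t i => t (Fin.castLE h i), by fun_prop⟩
  have hA : ∀ c : ℝ, 0 ≤ c → ∀ t, A (c • t) = c • A t := fun _ _ _ => rfl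
  have h₁ := krivine_comp (fun i : Fin n => x i) A hA (HomogFun.ofNorm Y m)
  have h₂ : (fun j => krivine (fun i : Fin n => x i) (HomogFun.comp A hA (HomogFun.proj j))) =
      fun i : Fin m => x i :=
    funext fun j => krivine_proj (fun i : Fin n => x i) (Fin.castLE h j)
  rw [h₂] at h₁
  rw [tauNorm, tauNorm, ← h₁]
  have hK := isKrivineCalculus_krivine fun i : Fin n => x i
  have h0 : 0 ≤ krivine (fun i : Fin n => x i) (HomogFun.comp A hA (HomogFun.ofNorm Y m)) :=
    hK.nonneg fun t => Y.finNorm_nonneg m _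
  refine norm_le_norm_of_abs_le_abs ?_
  rw [abs_of_nonneg h0]
  refine (hK.monotone fun t => ?_).trans (le_abs_self _)
  refine Y.solid_nrm _ _ (Y.padZero_mem n t) fun j => ?_
  rcases lt_or_ge j m with hj | hj
  · rw [padZero_apply_of_lt _ hj, padZero_apply_of_lt _ (hj.trans_le h)]
    rfl
  · simp [padZero_apply_of_le _ hj]

/-- With `A` the padding by zeros, both norms are read in the calculus of the shorter tuple. -/
theorem tauNorm_eq_of_forall_ge {x : ℕ → X} {m n : ℕ} (h : m ≤ n) (hx : ∀ j ≥ m, x j = 0) :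
    tauNorm Y (fun i : Fin n => x i) = tauNorm Y (fun i : Fin m => x i) := by
  let A : C(Fin m → ℝ, Fin n → ℝ) := ⟨fun t i => padZero m t i, by
    refine continuous_pi fun i => ?_
    exact (LinearMap.continuous_of_finiteDimensional
      (LinearMap.proj (i : ℕ) ∘ₗ padZero m : (Fin m → ℝ) →ₗ[ℝ] ℝ))⟩
  have hA : ∀ c : ℝ, 0 ≤ c → ∀ t, A (c • t) = c • A t := fun c _ t => by
    ext i
    exact congrFun ((padZero m).map_smul c t) i
  have h₁ := krivine_comp (fun i : Fin m => x i) A hA (HomogFun.ofNorm Y n)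
  have h₂ : (fun j => krivine (fun i : Fin m => x i) (HomogFun.comp A hA (HomogFun.proj j))) =
      fun i : Fin n => x i := by
    ext j
    rcases lt_or_ge (j : ℕ) m with hj | hj
    · rw [show HomogFun.comp A hA (HomogFun.proj j) = HomogFun.proj ⟨j, hj⟩ from
        Subtype.ext (ContinuousMap.ext fun t => padZero_apply_of_lt t hj), krivine_proj]
    · rw [show HomogFun.comp A hA (HomogFun.proj j) = 0 from
        Subtype.ext (ContinuousMap.ext fun t => padZero_apply_of_le t hj), map_zero, hx _ hj]
  have h₃ : HomogFun.comp A hA (HomogFun.ofNorm Y n) = HomogFun.ofNorm Y m := by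
    refine Subtype.ext (ContinuousMap.ext fun t => congrArg Y.nrm ?_)
    ext j
    rcases lt_or_ge j n with hj | hj
    · exact padZero_apply_of_lt _ hj
    · rw [padZero_apply_of_le _ hj, padZero_apply_of_le _ (h.trans hj)]
  rw [tauNorm, tauNorm, ← h₃, h₁, h₂]

/-- The concatenation `z` puts both tuples in one calculus; `A₁` and `A₂` extract its halves, and
the triangle inequality of `Y` transfers by monotonicity. -/
theorem tauNorm_sub_le {n : ℕ} (x y : Fin n → X) :
    tauNorm Y (x - y) ≤ tauNorm Y x + tauNorm Y y := by
  set z : Fin (n + n) → X := Fin.append x y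
  let A₁ : C(Fin (n + n) → ℝ, Fin n → ℝ) := ⟨fun t i => t (Fin.castAdd n i), by fun_prop⟩
  let A₂ : C(Fin (n + n) → ℝ, Fin n → ℝ) := ⟨fun t i => t (Fin.natAdd n i), by fun_prop⟩
  have hA₁ : ∀ c : ℝ, 0 ≤ c → ∀ t, A₁ (c • t) = c • A₁ t := fun _ _ _ => rfl
  have hA₂ : ∀ c : ℝ, 0 ≤ c → ∀ t, A₂ (c • t) = c • A₂ t := fun _ _ _ => rfl
  have hA : ∀ c : ℝ, 0 ≤ c → ∀ t, (A₁ - A₂) (c • t) = c • (A₁ - A₂) t := fun c hc t => by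
    rw [ContinuousMap.sub_apply, hA₁ c hc, hA₂ c hc, ContinuousMap.sub_apply, smul_sub]
  have e₁ : (fun j => krivine z (HomogFun.comp A₁ hA₁ (HomogFun.proj j))) = x :=
    funext fun j => (krivine_proj z (Fin.castAdd n j)).trans (Fin.append_left x y j)
  have e₂ : (fun j => krivine z (HomogFun.comp A₂ hA₂ (HomogFun.proj j))) = y :=
    funext fun j => (krivine_proj z (Fin.natAdd n j)).trans (Fin.append_right x y j)
  have e : (fun j => krivine z (HomogFun.comp (A₁ - A₂) hA (HomogFun.proj j))) = x - y := by
    rw [← e₁, ← e₂]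
    ext j
    exact map_sub (krivine z) (HomogFun.comp A₁ hA₁ (HomogFun.proj j))
      (HomogFun.comp A₂ hA₂ (HomogFun.proj j))
  have k₁ := krivine_comp z A₁ hA₁ (HomogFun.ofNorm Y n)
  have k₂ := krivine_comp z A₂ hA₂ (HomogFun.ofNorm Y n)
  have k := krivine_comp z (A₁ - A₂) hA (HomogFun.ofNorm Y n)
  rw [e₁] at k₁
  rw [e₂] at k₂
  rw [e] at k
  have hK := isKrivineCalculus_krivine z
  rw [tauNorm, tauNorm, tauNorm, ← k, ← k₁, ← k₂]
  refine le_trans (norm_le_norm_of_abs_le_abs ?_) (norm_add_le _ _)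
  rw [abs_of_nonneg (hK.nonneg fun t => Y.finNorm_nonneg n _), ← map_add]
  exact (hK.monotone fun t => Y.finNorm_sub_le n (A₁ t) (A₂ t)).trans (le_abs_self _)

theorem tauNorm_le_of_forall_ge {x : ℕ → X} {n : ℕ} (hx : ∀ j ≥ n, x j = 0) (k : ℕ) :
    tauNorm Y (fun i : Fin k => x i) ≤ tauNorm Y (fun i : Fin n => x i) :=
  (tauNorm_mono Y x (le_max_left k n)).trans
    (tauNorm_eq_of_forall_ge Y (le_max_right k n) hx).le

theorem EventuallyZero.mem_ellTau {x : ℕ → X} (hx : EventuallyZero x) : x ∈ ellTau Y X := by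
  obtain ⟨n, hn⟩ := hx
  exact ⟨_, Set.forall_mem_range.mpr (tauNorm_le_of_forall_ge Y hn)⟩

theorem ellTauNorm_padSeq_le {n : ℕ} (x : Fin n → X) : ellTauNorm Y (padSeq x) ≤ tauNorm Y x := by
  refine ciSup_le fun k => (tauNorm_le_of_forall_ge Y (fun _ => padSeq_of_le x) k).trans_eq ?_
  simp only [padSeq_coe]

theorem tauNorm_sub_le_ellTauNorm {x y : ℕ → X} (hx : x ∈ ellTau Y X) (hy : y ∈ ellTau Y X)
    (n : ℕ) : tauNorm Y (fun i : Fin n => (x - y) i) ≤ ellTauNorm Y x + ellTauNorm Y y :=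
  (tauNorm_sub_le Y (fun i : Fin n => x i) (fun i : Fin n => y i)).trans
    (add_le_add (tauNorm_le_ellTauNorm Y hx n) (tauNorm_le_ellTauNorm Y hy n))

theorem sub_mem_ellTau {x y : ℕ → X} (hx : x ∈ ellTau Y X) (hy : y ∈ ellTau Y X) :
    x - y ∈ ellTau Y X :=
  ⟨_, Set.forall_mem_range.mpr (tauNorm_sub_le_ellTauNorm Y hx hy)⟩

theorem ellTauNorm_sub_le {x y : ℕ → X} (hx : x ∈ ellTau Y X) (hy : y ∈ ellTau Y X) :
    ellTauNorm Y (x - y) ≤ ellTauNorm Y x + ellTauNorm Y y :=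
  ciSup_le (tauNorm_sub_le_ellTauNorm Y hx hy)

theorem mem_ellTauZero_of_eventuallyZero {x : ℕ → X} (hx : EventuallyZero x) :
    x ∈ ellTauZero Y X := by
  refine ⟨hx.mem_ellTau Y, fun ε hε => ⟨x, hx.mem_ellTau Y, hx, ?_⟩⟩
  -- The zero sequence is the padding of the empty tuple, on which the norm function vanishes.
  have h : x - x = padSeq (fun i : Fin 0 => x i) := by
    ext j
    rw [padSeq_of_le _ (Nat.zero_le j), sub_self, Pi.zero_apply]
  have h0 : HomogFun.ofNorm Y 0 = 0 := Subtype.ext (ContinuousMap.ext fun t => by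
    rw [Subsingleton.elim t 0]
    exact (congrArg Y.nrm (map_zero (padZero 0))).trans Y.nrm_zero)
  rw [h]
  refine (ellTauNorm_padSeq_le Y _).trans_lt ?_
  rwa [tauNorm, h0, map_zero, norm_zero]

theorem EventuallyZero.sub {V : Type*} [AddGroup V] {v w : ℕ → V} (hv : EventuallyZero v)
    (hw : EventuallyZero w) : EventuallyZero (v - w) := by
  obtain ⟨m, hm⟩ := hv
  obtain ⟨n, hn⟩ := hw
  refine ⟨max m n, fun j hj => ?_⟩
  rw [Pi.sub_apply, hm j (le_of_max_le_left hj), hn j (le_of_max_le_right hj), sub_zero]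

theorem sub_mem_ellTauZero {x v : ℕ → X} (hx : x ∈ ellTauZero Y X) (hv : v ∈ ellTau Y X)
    (hv0 : EventuallyZero v) : x - v ∈ ellTauZero Y X := by
  refine ⟨sub_mem_ellTau Y hx.1 hv, fun ε hε => ?_⟩
  obtain ⟨w, hw, hw0, hwε⟩ := hx.2 ε hε
  exact ⟨w - v, sub_mem_ellTau Y hw hv, hw0.sub hv0, by rwa [sub_sub_sub_cancel_right]⟩

end TauNorm

theorem EventuallyZero.assocOp {V W : Type*} [AddCommGroup V] [Module ℝ V] [AddCommGroup W]
    [Module ℝ W] (T : V →ₗ[ℝ] W) {v : ℕ → V} (hv : EventuallyZero v) :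
    EventuallyZero (assocOp T v) := by
  obtain ⟨n, hn⟩ := hv
  exact ⟨n, fun j hj => by simp [_root_.assocOp, hn j hj]⟩

/-! ### Convex operators. -/

section Convex

variable {E X : Type*} [NormedAddCommGroup E] [NormedSpace ℝ E]
  [NormedAddCommGroup X] [NormedSpace ℝ X] [Lattice X] {Y : BanachSeqLattice} {T : E →ₗ[ℝ] X}
  {C : ℝ}

theorem ConvexBound.tauNorm_assocOp_le (h : ConvexBound Y T C) (hC : 0 ≤ C) {w : ℕ → E}
    (hw : w ∈ ellY Y E) (n : ℕ) :
    tauNorm Y (fun i : Fin n => assocOp T w i) ≤ C * ellYNorm Y w :=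
  (h n fun i => w i).trans (mul_le_mul_of_nonneg_left (vecNorm_le_ellYNorm Y hw n) hC)

theorem ConvexBound.assocOp_mem_ellTau (h : ConvexBound Y T C) (hC : 0 ≤ C) {w : ℕ → E}
    (hw : w ∈ ellY Y E) : assocOp T w ∈ ellTau Y X :=
  ⟨_, Set.forall_mem_range.mpr (h.tauNorm_assocOp_le hC hw)⟩

theorem ConvexBound.ellTauNorm_assocOp_le (h : ConvexBound Y T C) (hC : 0 ≤ C) {w : ℕ → E}
    (hw : w ∈ ellY Y E) : ellTauNorm Y (assocOp T w) ≤ C * ellYNorm Y w :=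
  ciSup_le (h.tauNorm_assocOp_le hC hw)

theorem ConvexBound.assocOp_mem_ellTauZero (h : ConvexBound Y T C) (hC : 0 < C) {w : ℕ → E}
    (hw : w ∈ ellYZero Y E) : assocOp T w ∈ ellTauZero Y X := by
  refine ⟨h.assocOp_mem_ellTau hC.le hw.1, fun ε hε => ?_⟩
  obtain ⟨v, hv, hv0, hvε⟩ := hw.2 (ε / C) (div_pos hε hC)
  refine ⟨assocOp T v, h.assocOp_mem_ellTau hC.le hv, hv0.assocOp T, ?_⟩
  rw [← map_sub]
  refine (h.ellTauNorm_assocOp_le hC.le (sub_mem_ellY Y hw.1 hv)).trans_lt ?_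
  rwa [mul_comm, ← lt_div_iff₀ hC]

/-- Tuples are tested through their zero padding. The membership `hm` is essential: a real supremum
of an unbounded family takes the default value `0`. -/
theorem convexBound_of_forall_ellYZero
    (hm : ∀ w ∈ ellYZero Y E, assocOp T w ∈ ellTauZero Y X)
    (h : ∀ w ∈ ellYZero Y E, ellTauNorm Y (assocOp T w) ≤ C * ellYNorm Y w) :
    ConvexBound Y T C := by
  intro n w
  have hw := mem_ellYZero_of_eventuallyZero Y (eventuallyZero_padSeq w)
  calc tauNorm Y (fun i => T (w i))
      = tauNorm Y (fun i : Fin n => assocOp T (padSeq w) i) := by simp [assocOp, padSeq_coe]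
    _ ≤ ellTauNorm Y (assocOp T (padSeq w)) :=
      le_ciSup (f := fun n : ℕ => tauNorm Y (fun i : Fin n => assocOp T (padSeq w) i))
        (hm _ hw).1 n
    _ ≤ C * vecNorm Y w := by rw [← ellYNorm_padSeq]; exact h _ hw

end Convex

/-! ### Concave operators. -/

section Concave

variable {E X : Type*} [NormedAddCommGroup E] [NormedSpace ℝ E]
  [NormedAddCommGroup X] [NormedSpace ℝ X] [Lattice X]
  {Y : BanachSeqLattice} {S : X →ₗ[ℝ] E} {K : ℝ}

theorem ConcaveBound.norm_apply_mul_le (h : ConcaveBound Y S K) (hK : 0 ≤ K)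
    {x : ℕ → X} (hx : x ∈ ellTau Y X) (j : ℕ) :
    ‖S (x j)‖ * Y.nrm (Pi.single j 1) ≤ K * ellTauNorm Y x := by
  have h₁ := Y.abs_apply_mul_nrm_single_le
    (Y.padZero_mem (j + 1) fun i => ‖S (x i)‖) j
  rw [padZero_apply_of_lt _ (Nat.lt_succ_self j), abs_norm] at h₁
  exact h₁.trans ((h (j + 1) fun i => x i).trans
    (mul_le_mul_of_nonneg_left (tauNorm_le_ellTauNorm Y hx _) hK))

variable [CompleteSpace X] [IsOrderedAddMonoid X] [IsOrderedModule ℝ X] [HasSolidNorm X]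

theorem ConcaveBound.ellYNorm_assocOp_le_of_eventuallyZero (h : ConcaveBound Y S K) (hK : 0 ≤ K)
    {v : ℕ → X} (hv : EventuallyZero v) : ellYNorm Y (assocOp S v) ≤ K * ellTauNorm Y v := by
  have hm := hv.mem_ellTau Y
  obtain ⟨n, hn⟩ := hv
  rw [ellYNorm_eq_vecNorm Y (n := n) fun j hj => by simp [assocOp, hn j hj]]
  exact (h n fun i => v i).trans (mul_le_mul_of_nonneg_left (tauNorm_le_ellTauNorm Y hm n) hK)

/-- Bounded truncations do not suffice for membership in `Y` (a constant sequence for `Y = c_0`), so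
membership comes from approximation in `ℓ_0^{τ,Y}(X)` and completeness of `Y`. -/
theorem ConcaveBound.assocOp_mem_ellY_and_ellYNorm_le (h : ConcaveBound Y S K) (hK : 0 ≤ K)
    {x : ℕ → X} (hx : x ∈ ellTauZero Y X) :
    assocOp S x ∈ ellY Y E ∧ ellYNorm Y (assocOp S x) ≤ K * ellTauNorm Y x := by
  choose v hv hv0 hvε using fun m : ℕ => hx.2 _ (Nat.one_div_pos_of_nat (n := m) (α := ℝ))
  have hδ := tendsto_one_div_add_atTop_nhds_zero_nat (𝕜 := ℝ)
  set u : ℕ → ℕ → ℝ := fun m j => ‖assocOp S (v m) j‖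
  have hu : ∀ m, u m ∈ Y.carrier := fun m => ((hv0 m).assocOp S).mem_ellY Y
  have huv : ∀ m k, Y.nrm (u m - u k) ≤ K * (1 / ((k : ℝ) + 1) + 1 / ((m : ℝ) + 1)) := by
    intro m k
    have h₀ := (hv0 m).sub (hv0 k)
    calc Y.nrm (u m - u k) ≤ ellYNorm Y (assocOp S (v m - v k)) := by
          refine Y.solid_nrm _ _ ((h₀.assocOp S).mem_ellY Y) fun j => ?_
          rw [abs_norm, map_sub]
          exact abs_norm_sub_norm_le _ _
      _ ≤ K * ellTauNorm Y (v m - v k) := h.ellYNorm_assocOp_le_of_eventuallyZero hK h₀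
      _ ≤ _ := by
          refine mul_le_mul_of_nonneg_left ?_ hK
          -- Writes `v m - v k` as `(x - v k) - (x - v m)`.
          rw [← sub_sub_sub_cancel_left (v k) (v m) x]
          exact (ellTauNorm_sub_le Y (sub_mem_ellTau Y hx.1 (hv k))
            (sub_mem_ellTau Y hx.1 (hv m))).trans (add_le_add (hvε k).le (hvε m).le)
  obtain ⟨f, hf, hlim⟩ := Y.complete u hu fun ε hε => by
    have ht : Filter.Tendsto (fun N : ℕ => K * (1 / ((N : ℝ) + 1) + 1 / ((N : ℝ) + 1)))
        Filter.atTop (nhds 0) := by simpa using (hδ.add hδ).const_mul K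
    obtain ⟨N, hN⟩ := (ht.eventually (gt_mem_nhds hε)).exists
    refine ⟨N, fun m hm k hk => (huv m k).trans_lt (lt_of_le_of_lt ?_ hN)⟩
    exact mul_le_mul_of_nonneg_left
      (add_le_add (Nat.one_div_le_one_div hk) (Nat.one_div_le_one_div hm)) hK
  have ha : Filter.Tendsto (fun m => Y.nrm (u m - f)) Filter.atTop (nhds 0) := by
    refine Metric.tendsto_atTop.mpr fun ε hε => ?_
    obtain ⟨N, hN⟩ := hlim ε hε
    refine ⟨N, fun m hm => ?_⟩
    rw [Real.dist_0_eq_abs, abs_of_nonneg (Y.nrm_nonneg (Y.carrier.sub_mem (hu m) hf))]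
    exact hN m hm
  -- In each coordinate `u m` tends to `f` and also to the norms of the images of `x`.
  have hfx : (fun j => ‖assocOp S x j‖) = f := by
    ext j
    set c := Y.nrm (Pi.single j 1)
    have hc : 0 < c := Y.nrm_single_pos j
    have hle : ∀ m : ℕ, |‖assocOp S x j‖ - f j| * c ≤
        K * (1 / ((m : ℝ) + 1)) + Y.nrm (u m - f) := by
      intro m
      have h₁ : ‖S ((x - v m) j)‖ * c ≤ K * (1 / ((m : ℝ) + 1)) :=
        (h.norm_apply_mul_le hK (sub_mem_ellTau Y hx.1 (hv m)) j).trans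
          (mul_le_mul_of_nonneg_left (hvε m).le hK)
      have h₂ : |u m j - f j| * c ≤ Y.nrm (u m - f) :=
        Y.abs_apply_mul_nrm_single_le (Y.carrier.sub_mem (hu m) hf) j
      have h₃ : |‖assocOp S x j‖ - u m j| ≤ ‖S ((x - v m) j)‖ := by
        rw [Pi.sub_apply, map_sub]
        exact abs_norm_sub_norm_le _ _
      calc |‖assocOp S x j‖ - f j| * c
          ≤ (‖S ((x - v m) j)‖ + |u m j - f j|) * c :=
            mul_le_mul_of_nonneg_right
              ((abs_sub_le _ (u m j) _).trans (add_le_add h₃ le_rfl)) hc.le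
        _ ≤ _ := by rw [add_mul]; exact add_le_add h₁ h₂
    have h₀ := ge_of_tendsto' ((hδ.const_mul K).add ha) hle
    rw [mul_zero, add_zero] at h₀
    have := le_antisymm (nonpos_of_mul_nonpos_left h₀ hc) (abs_nonneg _)
    exact sub_eq_zero.mp (abs_eq_zero.mp this)
  refine ⟨?_, ?_⟩
  · change (fun j => ‖assocOp S x j‖) ∈ Y.carrier
    rwa [hfx]
  · rw [ellYNorm, hfx]
    have hle : ∀ m : ℕ, Y.nrm f ≤
        K * (ellTauNorm Y x + 1 / ((m : ℝ) + 1)) + Y.nrm (u m - f) := by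
      intro m
      have h₁ : Y.nrm (u m) ≤ K * (ellTauNorm Y x + 1 / ((m : ℝ) + 1)) := by
        refine (h.ellYNorm_assocOp_le_of_eventuallyZero hK (hv0 m)).trans
          (mul_le_mul_of_nonneg_left ?_ hK)
        have := ellTauNorm_sub_le Y hx.1 (sub_mem_ellTau Y hx.1 (hv m))
        rw [sub_sub_cancel] at this
        linarith [hvε m]
      have h₂ := Y.nrm_add_le _ (hu m) _ (Y.carrier.sub_mem hf (hu m))
      rw [add_sub_cancel, Y.nrm_sub_comm hf (hu m)] at h₂
      linarith
    have := ge_of_tendsto' (((hδ.const_add (ellTauNorm Y x)).const_mul K).add ha) hle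
    rwa [add_zero, add_zero] at this

theorem ConcaveBound.assocOp_mem_ellYZero (h : ConcaveBound Y S K) (hK : 0 < K)
    {x : ℕ → X} (hx : x ∈ ellTauZero Y X) : assocOp S x ∈ ellYZero Y E := by
  refine ⟨(h.assocOp_mem_ellY_and_ellYNorm_le hK.le hx).1, fun ε hε => ?_⟩
  obtain ⟨v, hv, hv0, hvε⟩ := hx.2 (ε / K) (div_pos hε hK)
  have hv1 := hv0.assocOp S
  refine ⟨assocOp S v, hv1.mem_ellY Y, hv1, ?_⟩
  rw [← map_sub]
  refine (h.assocOp_mem_ellY_and_ellYNorm_le hK.le (sub_mem_ellTauZero Y hx hv hv0)).2.trans_lt ?_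
  rwa [mul_comm, ← lt_div_iff₀ hK]

theorem concaveBound_of_forall_ellTauZero (hK : 0 ≤ K)
    (h : ∀ x ∈ ellTauZero Y X, ellYNorm Y (assocOp S x) ≤ K * ellTauNorm Y x) :
    ConcaveBound Y S K := by
  intro n x
  have e : assocOp S (padSeq x) = padSeq fun i => S (x i) := by
    ext j
    rcases lt_or_ge j n with hj | hj
    · simp [assocOp, padSeq, hj]
    · simp [assocOp, padSeq_of_le _ hj]
  rw [← ellYNorm_padSeq, ← e]
  exact (h _ (mem_ellTauZero_of_eventuallyZero Y (eventuallyZero_padSeq x))).trans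
    (mul_le_mul_of_nonneg_left (ellTauNorm_padSeq_le Y x) hK)

end Concave

end

/-! ### The theorem. -/

theorem mainTheorem5 (Y : BanachSeqLattice)
    {E : Type*} [NormedAddCommGroup E] [NormedSpace ℝ E] [CompleteSpace E]
    {X : Type*} [NormedAddCommGroup X] [NormedSpace ℝ X] [CompleteSpace X]
    [Lattice X] [IsOrderedAddMonoid X] [IsOrderedModule ℝ X] [HasSolidNorm X] :
    (∀ T : E →ₗ[ℝ] X,
      (IsYConvex Y T ↔
        IsBoundedOp (ellYZero Y E) (ellYNorm Y) (ellTauZero Y X) (ellTauNorm Y) (assocOp T)) ∧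
      (IsYConvex Y T →
        opNormOn (ellYZero Y E) (ellYNorm Y) (ellTauNorm Y) (assocOp T) = convexConst Y T)) ∧
    (∀ S : X →ₗ[ℝ] E,
      (IsYConcave Y S ↔
        IsBoundedOp (ellTauZero Y X) (ellTauNorm Y) (ellYZero Y E) (ellYNorm Y) (assocOp S)) ∧
      (IsYConcave Y S →
        opNormOn (ellTauZero Y X) (ellTauNorm Y) (ellYNorm Y) (assocOp S) = concaveConst Y S)) := by
  refine ⟨fun T => ⟨⟨?_, ?_⟩, ?_⟩, fun S => ⟨⟨?_, ?_⟩, ?_⟩⟩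
  · rintro ⟨C, hC, h⟩
    exact ⟨fun w hw => h.assocOp_mem_ellTauZero hC hw,
      C, fun w hw => h.ellTauNorm_assocOp_le hC.le hw.1⟩
  · rintro ⟨hm, C, h⟩
    -- A bound for the operator may be nonpositive, while convexity asks for a positive constant.
    exact ⟨max C 1, by positivity, convexBound_of_forall_ellYZero hm fun w hw => (h w hw).trans
      (mul_le_mul_of_nonneg_right (le_max_left C 1) (ellYNorm_nonneg Y hw.1))⟩
  · rintro ⟨C₀, hC₀, h₀⟩
    -- The two sets of constants are equal; `h₀` supplies the membership that excludes default
    -- suprema.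
    refine congrArg sInf (Set.ext fun C => and_congr_right fun hC => ⟨fun h => ?_, fun h w hw => ?_⟩)
    · exact convexBound_of_forall_ellYZero (fun w hw => h₀.assocOp_mem_ellTauZero hC₀ hw) h
    · exact h.ellTauNorm_assocOp_le hC hw.1
  · rintro ⟨K, hK, h⟩
    exact ⟨fun x hx => h.assocOp_mem_ellYZero hK hx,
      K, fun x hx => (h.assocOp_mem_ellY_and_ellYNorm_le hK.le hx).2⟩
  · rintro ⟨-, K, h⟩
    exact ⟨max K 1, by positivity, concaveBound_of_forall_ellTauZero (by positivity)
      fun x hx => (h x hx).trans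
        (mul_le_mul_of_nonneg_right (le_max_left K 1) (ellTauNorm_nonneg Y x))⟩
  · rintro -
    refine congrArg sInf (Set.ext fun K => and_congr_right fun hK => ⟨fun h => ?_, fun h x hx => ?_⟩)
    · exact concaveBound_of_forall_ellTauZero hK h
    · exact (h.assocOp_mem_ellY_and_ellYNorm_le hK hx).2
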